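/- Let $\mathcal H$ be a complex Hilbert space and let $A:\mathcal D(A)\subseteq\mathcal H\to\mathcal H$ be a self-adjoint operator with $0\in\rho(A)$ (for instance, $-A\ge c$ for some constant $c>0$). Equip $\mathcal D(A)$ with the graph norm $(\|A\phi\|^2+\|\phi\|^2)^{1/2}$, and let $n$ be a non-negative integer. For a bounded surjective linear map $\tau:\mathcal D(A)\to\mathbb C^n$ whose kernel is dense in $\mathcal H$, put $G_z:=\big(\tau(-A+\bar z)^{-1}\big)^*:\mathbb C^n\to\mathcal H$ for $z\in\rho(A)$. For an orthogonal projector $\Pi$ on $\mathbb C^n$ with range $\mathbb C^n_\Pi$ and a symmetric operator $\Theta:\mathbb C^n_\Pi\to\mathbb C^n_\Pi$, let $A^{\Pi,\Theta}$ be the operator $$\mathcal D(A^{\Pi,\Theta})=\{\phi=\phi_0+G_0\xi\,:\,\phi_0\in\mathcal D(A),\ \xi\in\mathbb C^n_\Pi,\ \Pi\tau\phi_0=\Theta\xi\},\qquad A^{\Pi,\Theta}\phi=A\phi_0 ,$$ which is well defined because $\ker\tau$ is dense. Let $\tau_N:\mathcal D(A)\to\mathbb C^n$ ($N\in\mathbb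 N$) and $\tau:\mathcal D(A)\to\mathbb C^n$ be bounded surjective linear maps with kernels dense in $\mathcal H$, such that $\tau_N\to\tau$ in operator norm. Let $\Pi$ be an orthogonal projector on $\mathbb C^n$, and let $\Theta_N$ and $\Theta$ be symmetric operators on $\mathbb C^n_\Pi$ with $\Theta_N\to\Theta$. Let $A_N^{\Pi,\Theta_N}$ be the operator constructed as above from $\tau_N$ and $\Theta_N$, and $A^{\Pi,\Theta}$ the one constructed from $\tau$ and $\Theta$. Then $A_N^{\Pi,\Theta_N}$ and $A^{\Pi,\Theta}$ are self-adjoint extensions of $A|_{\ker\tau_N}$ and $A|_{\ker\tau}$ respectively, and $A_N^{\Pi,\Theta_N}$ converges to $A^{\Pi,\Theta}$ in norm resolvent sense as $N\to\infty$, i.e. for every $z\in\mathbb C\setminus\mathbb R$ $$\big\|(-A_N^{\Pi,\Theta_N}+z)^{-1}-(-A^{\Pi,\Theta}+z)^{-1}\big\|\to0 .$$ -/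

import Mathlib

open Filter Topology
open scoped InnerProductSpace ComplexConjugate

noncomputable section

namespace LinearPMap

variable {H : Type*} [NormedAddCommGroup H] [InnerProductSpace ℂ H]

/-! ### Resolvents of unbounded operators -/

/-- `R` is a bounded, everywhere defined, two-sided inverse of `-T + z : D(T) → H`. -/
def IsResolventAt (T : H →ₗ.[ℂ] H) (z : ℂ) (R : H →L[ℂ] H) : Prop :=
  (∀ x : T.domain, R (-T x + z • (x : H)) = x) ∧
    ∀ y : H, ∃ h : R y ∈ T.domain, -T ⟨R y, h⟩ + z • R y = y

/-- The resolvent set `ρ(T)`: those `z` for which `-T + z : D(T) → H` is a bijection with bounded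
inverse. -/
def resolventSet (T : H →ₗ.[ℂ] H) : Set ℂ :=
  {z | ∃ R : H →L[ℂ] H, T.IsResolventAt z R}

open Classical in
/-- The resolvent `(-T + z)⁻¹` as a bounded operator on `H`, for `z ∈ ρ(T)`
(and `0` for `z ∉ ρ(T)`). -/
def resolvent (T : H →ₗ.[ℂ] H) (z : ℂ) : H →L[ℂ] H :=
  if h : z ∈ T.resolventSet then h.choose else 0

theorem isResolventAt_resolvent {T : H →ₗ.[ℂ] H} {z : ℂ} (h : z ∈ T.resolventSet) :
    T.IsResolventAt z (T.resolvent z) := by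
  rw [resolvent, dif_pos h]
  exact h.choose_spec

theorem IsResolventAt.mem_resolventSet {T : H →ₗ.[ℂ] H} {z : ℂ} {R : H →L[ℂ] H}
    (h : T.IsResolventAt z R) : z ∈ T.resolventSet := ⟨R, h⟩

theorem IsResolventAt.resolvent_eq {T : H →ₗ.[ℂ] H} {z : ℂ} {R : H →L[ℂ] H}
    (h : T.IsResolventAt z R) : T.resolvent z = R := by
  ext y
  obtain ⟨hy, e⟩ := h.2 y
  have := (isResolventAt_resolvent h.mem_resolventSet).1 ⟨R y, hy⟩
  rw [e] at this
  exact this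

theorem resolvent_mem_domain (T : H →ₗ.[ℂ] H) (z : ℂ) (y : H) : T.resolvent z y ∈ T.domain := by
  by_cases h : z ∈ T.resolventSet
  · exact ((isResolventAt_resolvent h).2 y).1
  · rw [resolvent, dif_neg h]
    exact T.domain.zero_mem

/-- `T N` converges to `T∞` in norm resolvent sense: all these operators are self-adjoint and, for
every non-real `z` (which then belongs to all the resolvent sets), the resolvents
`(-T N + z)⁻¹` converge to `(-T∞ + z)⁻¹` in operator norm. -/
def NormResolventTendsto [CompleteSpace H] (T : ℕ → H →ₗ.[ℂ] H) (Tlim : H →ₗ.[ℂ] H) : Prop :=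
  (∀ N, IsSelfAdjoint (T N)) ∧ IsSelfAdjoint Tlim ∧
    ∀ z : ℂ, z.im ≠ 0 →
      (∀ N, z ∈ (T N).resolventSet) ∧ z ∈ Tlim.resolventSet ∧
        Tendsto (fun N => (T N).resolvent z) atTop (𝓝 (Tlim.resolvent z))

/-! ### The domain of an operator with its graph norm -/

/-- The domain `D(A)`, to be equipped with the graph norm `(‖A φ‖² + ‖φ‖²)^{1/2}`. -/
def GraphDomain (A : H →ₗ.[ℂ] H) : Type _ := A.domain

namespace GraphDomain

variable (A : H →ₗ.[ℂ] H)

instance : AddCommGroup (GraphDomain A) := inferInstanceAs (AddCommGroup A.domain)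

instance : Module ℂ (GraphDomain A) := inferInstanceAs (Module ℂ A.domain)

/-- The identity, from `D(A)` with the graph norm to the plain subspace `D(A)` of `H`. -/
def toDomain : GraphDomain A ≃ₗ[ℂ] A.domain := LinearEquiv.refl ℂ A.domain

/-- `φ ↦ (φ, A φ)`, with values in the Hilbert sum `H ⊕ H`. -/
def toGraph : GraphDomain A →ₗ[ℂ] WithLp 2 (H × H) :=
  (WithLp.linearEquiv 2 ℂ (H × H)).symm.toLinearMap ∘ₗ
    (A.domain.subtype.prod A.toFun) ∘ₗ (toDomain A).toLinearMap

theorem toGraph_injective : Function.Injective (toGraph A) := by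
  intro x y h
  have h' := congrArg (fun p : WithLp 2 (H × H) => p.fst) h
  exact (toDomain A).injective (Subtype.ext h')

instance : NormedAddCommGroup (GraphDomain A) :=
  NormedAddCommGroup.induced (GraphDomain A) (WithLp 2 (H × H)) (toGraph A) (toGraph_injective A)

instance : NormedSpace ℂ (GraphDomain A) :=
  NormedSpace.induced ℂ (GraphDomain A) (WithLp 2 (H × H)) (toGraph A)

theorem norm_eq (x : GraphDomain A) :
    ‖x‖ = √(‖((toDomain A x : A.domain) : H)‖ ^ 2 + ‖A (toDomain A x)‖ ^ 2) :=
  WithLp.prod_norm_eq_of_L2 (toGraph A x)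

end GraphDomain

/-- The resolvent `(-A + z)⁻¹` as a linear map from `H` to `D(A)`. -/
def resolventₗ (A : H →ₗ.[ℂ] H) (z : ℂ) : H →ₗ[ℂ] GraphDomain A :=
  (GraphDomain.toDomain A).symm.toLinearMap ∘ₗ
    LinearMap.codRestrict A.domain (A.resolvent z).toLinearMap (A.resolvent_mem_domain z)

theorem resolventₗ_bound (A : H →ₗ.[ℂ] H) (z : ℂ) :
    ∃ C : ℝ, ∀ y, ‖A.resolventₗ z y‖ ≤ C * ‖y‖ := by
  by_cases h : z ∈ A.resolventSet
  · refine ⟨‖A.resolvent z‖ + (‖z‖ * ‖A.resolvent z‖ + 1), fun y => ?_⟩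
    obtain ⟨hy, e⟩ := (isResolventAt_resolvent h).2 y
    have e' : A ⟨A.resolvent z y, hy⟩ = z • A.resolvent z y - y := by
      rw [eq_sub_iff_add_eq]
      exact (neg_add_eq_iff_eq_add.mp e).symm
    have h1 : ‖A.resolvent z y‖ ≤ ‖A.resolvent z‖ * ‖y‖ := (A.resolvent z).le_opNorm y
    have h2 : ‖A ⟨A.resolvent z y, hy⟩‖ ≤ (‖z‖ * ‖A.resolvent z‖ + 1) * ‖y‖ := by
      rw [e']
      refine (norm_sub_le _ _).trans ?_
      rw [norm_smul]
      nlinarith [norm_nonneg z]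
    rw [GraphDomain.norm_eq]
    change √(‖A.resolvent z y‖ ^ 2 + ‖A ⟨A.resolvent z y, hy⟩‖ ^ 2) ≤ _
    refine Real.sqrt_le_iff.mpr ⟨by positivity, ?_⟩
    nlinarith [norm_nonneg (A.resolvent z y), norm_nonneg (A ⟨A.resolvent z y, hy⟩)]
  · refine ⟨0, fun y => ?_⟩
    have h0 : A.resolventₗ z y = 0 := by
      apply (GraphDomain.toDomain A).injective
      apply Subtype.ext
      change A.resolvent z y = 0
      rw [resolvent, dif_neg h]
      rfl
    rw [h0]
    simp

/-- The resolvent `(-A + z)⁻¹` as a bounded operator from `H` to `D(A)` with the graph norm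
(for `z ∈ ρ(A)`; it is `0` otherwise). -/
def resolventToDomain (A : H →ₗ.[ℂ] H) (z : ℂ) : H →L[ℂ] GraphDomain A :=
  ⟨A.resolventₗ z, AddMonoidHomClass.continuous_of_bound (A.resolventₗ z) _
    (A.resolventₗ_bound z).choose_spec⟩

/-! ### Restrictions to kernels and their extensions -/

variable {n : ℕ}

/-- The restriction `A|ker τ`. -/
def restrictKer (A : H →ₗ.[ℂ] H) (τ : GraphDomain A →L[ℂ] EuclideanSpace ℂ (Fin n)) :
    H →ₗ.[ℂ] H :=
  A.domRestrict ((LinearMap.ker τ.toLinearMap).map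
    (A.domain.subtype ∘ₗ (GraphDomain.toDomain A).toLinearMap))

theorem mem_restrictKer_domain (A : H →ₗ.[ℂ] H)
    (τ : GraphDomain A →L[ℂ] EuclideanSpace ℂ (Fin n)) (x : H) :
    x ∈ (A.restrictKer τ).domain ↔
      ∃ φ : GraphDomain A, τ φ = 0 ∧ (GraphDomain.toDomain A φ : H) = x := by
  constructor
  · rintro ⟨⟨φ, hφ, e⟩, -⟩
    exact ⟨φ, hφ, e⟩
  · rintro ⟨φ, hφ, rfl⟩
    exact ⟨⟨φ, hφ, rfl⟩, (GraphDomain.toDomain A φ).2⟩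

variable [CompleteSpace H]

/-- `G_z = (τ (-A + z̄)⁻¹)* : ℂⁿ → H`. -/
def gammaField (A : H →ₗ.[ℂ] H) (τ : GraphDomain A →L[ℂ] EuclideanSpace ℂ (Fin n)) (z : ℂ) :
    EuclideanSpace ℂ (Fin n) →L[ℂ] H :=
  ContinuousLinearMap.adjoint (τ ∘L A.resolventToDomain (conj z))

/-- The graph of `A^{Π,Θ}`: all pairs `(φ₀ + G₀ ξ, A φ₀)` with `φ₀ ∈ D(A)`, `ξ ∈ ran Π` and
`Π τ φ₀ = Θ ξ`. -/
def extensionGraph (A : H →ₗ.[ℂ] H) (τ : GraphDomain A →L[ℂ] EuclideanSpace ℂ (Fin n))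
    (P : EuclideanSpace ℂ (Fin n) →L[ℂ] EuclideanSpace ℂ (Fin n))
    (Θ : P.range →L[ℂ] P.range) : Submodule ℂ (H × H) where
  carrier := {p | ∃ (φ₀ : GraphDomain A) (ξ : P.range),
    P (τ φ₀) = (Θ ξ : EuclideanSpace ℂ (Fin n)) ∧
      p = ((GraphDomain.toDomain A φ₀ : H) + A.gammaField τ 0 (ξ : EuclideanSpace ℂ (Fin n)),
        A (GraphDomain.toDomain A φ₀))}
  zero_mem' := ⟨0, 0, by simp, by simp [LinearPMap.map_zero]; rfl⟩
  add_mem' := by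
    rintro _ _ ⟨φ, ξ, h, rfl⟩ ⟨ψ, η, k, rfl⟩
    refine ⟨φ + ψ, ξ + η, by simp [h, k], ?_⟩
    ext
    · simp only [Prod.mk_add_mk, _root_.map_add, Submodule.coe_add]
      abel
    · simp [LinearPMap.map_add]
  smul_mem' := by
    rintro c _ ⟨φ, ξ, h, rfl⟩
    refine ⟨c • φ, c • ξ, by simp [h], ?_⟩
    ext <;> simp [LinearPMap.map_smul]

/-- The operator `A^{Π,Θ}`, `A^{Π,Θ} φ = A φ₀` on
`{φ = φ₀ + G₀ ξ : φ₀ ∈ D(A), ξ ∈ ran Π, Π τ φ₀ = Θ ξ}`. It is well defined when `ker τ` is dense,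
see `extension_graph`. -/
def extension (A : H →ₗ.[ℂ] H) (τ : GraphDomain A →L[ℂ] EuclideanSpace ℂ (Fin n))
    (P : EuclideanSpace ℂ (Fin n) →L[ℂ] EuclideanSpace ℂ (Fin n))
    (Θ : P.range →L[ℂ] P.range) : H →ₗ.[ℂ] H :=
  (A.extensionGraph τ P Θ).toLinearPMap

theorem extension_graph {A : H →ₗ.[ℂ] H} (hA : IsSelfAdjoint A) (h0 : (0 : ℂ) ∈ A.resolventSet)
    {τ : GraphDomain A →L[ℂ] EuclideanSpace ℂ (Fin n)}
    (hτ : Dense ((A.restrictKer τ).domain : Set H))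
    (P : EuclideanSpace ℂ (Fin n) →L[ℂ] EuclideanSpace ℂ (Fin n))
    (Θ : P.range →L[ℂ] P.range) :
    (A.extension τ P Θ).graph = A.extensionGraph τ P Θ := by
  refine Submodule.toLinearPMap_graph_eq _ ?_
  rintro _ ⟨φ, ξ, -, rfl⟩ hx
  simp only at hx ⊢
  refine hτ.eq_zero_of_inner_left (𝕜 := ℂ) (fun x hx' => ?_)
  obtain ⟨ψ, hψ, rfl⟩ := (mem_restrictKer_domain A τ x).1 hx'
  have hsym : ⟪A (GraphDomain.toDomain A φ), (GraphDomain.toDomain A ψ : H)⟫_ℂ =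
      ⟪(GraphDomain.toDomain A φ : H), A (GraphDomain.toDomain A ψ)⟫_ℂ := by
    have := A.adjoint_isFormalAdjoint hA.dense_domain
    rw [LinearPMap.isSelfAdjoint_def.mp hA] at this
    exact this _ _
  have hR : A.resolventToDomain 0 (A (GraphDomain.toDomain A ψ)) = -ψ := by
    apply (GraphDomain.toDomain A).injective
    apply Subtype.ext
    have := (isResolventAt_resolvent h0).1 (GraphDomain.toDomain A ψ)
    rw [zero_smul, add_zero, _root_.map_neg] at this
    rw [_root_.map_neg, Submodule.coe_neg, ← this, neg_neg]
    rfl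
  have hG : ⟪A.gammaField τ 0 (ξ : EuclideanSpace ℂ (Fin n)),
      A (GraphDomain.toDomain A ψ)⟫_ℂ = 0 := by
    rw [gammaField, ContinuousLinearMap.adjoint_inner_left, _root_.map_zero,
      ContinuousLinearMap.comp_apply, hR, _root_.map_neg, hψ, neg_zero, inner_zero_right]
  have hsum := congrArg (fun v => ⟪v, A (GraphDomain.toDomain A ψ)⟫_ℂ) hx
  simp only [inner_add_left, hG, add_zero, inner_zero_left] at hsum
  rw [hsym, hsum]

end LinearPMap

end

/-! Since 0 ∈ ρ(A), bounded operators encode `A^{Π,Θ}`. Put K = A⁻¹, J = G₀ on ran Π and ψ = Aφ₀.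
The operator sends Kψ + Jξ to ψ, and because J* = Πτ(-A)⁻¹ the boundary condition reads J*ψ + Θξ = 0
(`isSingularPerturbation_extension`). For non-real z put S = (zK - 1)⁻¹. Solving -ψ + z(Kψ + Jξ) = y
gives ψ = S(y - zJξ), and the boundary condition becomes Wξ = -J*Sy with W = Θ - zJ*SJ. A nonzero
kernel vector of W would give a symmetric operator a non-real eigenvalue, so W is invertible
(`isUnit_weylOperator`). This yields self-adjointness, and an explicit resolvent that is norm
continuous in (J, Θ) (`tendsto_kreinResolvent`). Only J and Θ vary with N, and J depends
continuously on τ. -/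

noncomputable section

namespace LinearPMap

/-! ### Symmetric operators and the self-adjointness criterion -/

section Symmetric

variable {H : Type*} [NormedAddCommGroup H] [InnerProductSpace ℂ H]

/-- A symmetric operator has no non-real eigenvalues. -/
theorem IsFormalAdjoint.eq_zero_of_apply_eq_smul {T : H →ₗ.[ℂ] H} (hT : T.IsFormalAdjoint T)
    {z : ℂ} (hz : z.im ≠ 0) {x : T.domain} (hx : T x = z • (x : H)) : (x : H) = 0 := by
  have h := hT x x
  rw [hx, inner_smul_left, inner_smul_right] at h
  have h2 : (conj z - z) * ⟪(x : H), (x : H)⟫_ℂ = 0 := by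
    rw [sub_mul, h, sub_self]
  rcases mul_eq_zero.1 h2 with h3 | h3
  · exact absurd (Complex.conj_eq_iff_im.1 (sub_eq_zero.1 h3)) hz
  · exact inner_self_eq_zero.1 h3

/-- A bounded right inverse of `-T + z`, for `T` symmetric and `z` non-real, is the resolvent. -/
theorem IsFormalAdjoint.isResolventAt {T : H →ₗ.[ℂ] H} (hT : T.IsFormalAdjoint T)
    {z : ℂ} (hz : z.im ≠ 0) {R : H →L[ℂ] H}
    (hR : ∀ y, ∃ h : R y ∈ T.domain, -T ⟨R y, h⟩ + z • R y = y) : T.IsResolventAt z R := by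
  refine ⟨fun x => ?_, hR⟩
  obtain ⟨h, e⟩ := hR (-T x + z • (x : H))
  have key : T (⟨_, h⟩ - x) = z • ((⟨_, h⟩ - x : T.domain) : H) := by
    rw [LinearPMap.map_sub, Submodule.coe_sub, smul_sub]
    linear_combination (norm := module) -e
  exact sub_eq_zero.1 (hT.eq_zero_of_apply_eq_smul hz key)

/-- The basic criterion for self-adjointness. -/
theorem IsFormalAdjoint.isSelfAdjoint [CompleteSpace H] {T : H →ₗ.[ℂ] H}
    (hT : T.IsFormalAdjoint T) (hd : Dense (T.domain : Set H)) {z : ℂ}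
    (hz : ∀ y, ∃ x : T.domain, -T x + z • (x : H) = y)
    (hz' : ∀ y, ∃ x : T.domain, -T x + conj z • (x : H) = y) : IsSelfAdjoint T := by
  have hle : T ≤ T† := hT.le_adjoint hd
  refine (isSelfAdjoint_def.2 (eq_of_le_of_domain_eq hle (le_antisymm hle.1 ?_)).symm)
  intro w hw
  -- x ∈ D(T) is chosen so that w - x lies in ker(T† - z).
  obtain ⟨x, hx⟩ := hz (-T† ⟨w, hw⟩ + z • w)
  have hxT : T† ⟨x, hle.1 x.2⟩ = T x := (hle.2 (x := x) (y := ⟨x, hle.1 x.2⟩) rfl).symm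
  have key : T† (⟨w, hw⟩ - ⟨x, hle.1 x.2⟩) = z • (w - x) := by
    rw [LinearPMap.map_sub, hxT, smul_sub]
    linear_combination (norm := module) hx
  -- ker(T† - z) is orthogonal to ran(-T + z̄), which is all of H, so w - x is orthogonal to itself.
  obtain ⟨v, hv⟩ := hz' (w - x)
  have h := T.adjoint_isFormalAdjoint hd (⟨w, hw⟩ - ⟨x, hle.1 x.2⟩) v
  rw [key, inner_smul_left] at h
  have h0 : ⟪w - x, w - x⟫_ℂ = 0 := by
    nth_rewrite 2 [← hv]
    rw [inner_add_right, inner_neg_right, inner_smul_right, h]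
    exact neg_add_cancel _
  rw [sub_eq_zero.1 (inner_self_eq_zero.1 h0)]
  exact x.2

end Symmetric

/-! ### Krein's resolvent formula from bounded data -/

section Krein

variable {H V : Type*} [NormedAddCommGroup H] [InnerProductSpace ℂ H] [CompleteSpace H]
  [NormedAddCommGroup V] [InnerProductSpace ℂ V] [CompleteSpace V]

/-- `T` is the operator `K ψ + J ξ ↦ ψ`, on the set of those vectors for which `J* ψ + Θ ξ = 0`. -/
def IsSingularPerturbation (T : H →ₗ.[ℂ] H) (K : H →L[ℂ] H) (J : V →L[ℂ] H) (Θ : V →L[ℂ] V) :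
    Prop :=
  ∀ x y : H, (x, y) ∈ T.graph ↔ ∃ ξ : V, ContinuousLinearMap.adjoint J y + Θ ξ = 0 ∧ x = K y + J ξ

/-- The operator `Θ - z J* (z K - 1)⁻¹ J`. -/
def weylOperator (K : H →L[ℂ] H) (z : ℂ) (J : V →L[ℂ] H) (Θ : V →L[ℂ] V) : V →L[ℂ] V :=
  Θ - z • (ContinuousLinearMap.adjoint J ∘L Ring.inverse (z • K - 1) ∘L J)

/-- The vector `ξ` in the decomposition `K ψ + J ξ` of the resolvent. -/
def chargeMap (K : H →L[ℂ] H) (z : ℂ) (J : V →L[ℂ] H) (Θ : V →L[ℂ] V) : H →L[ℂ] V :=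
  -(Ring.inverse (weylOperator K z J Θ) ∘L ContinuousLinearMap.adjoint J ∘L Ring.inverse (z • K - 1))

/-- Krein's formula for the resolvent. -/
def kreinResolvent (K : H →L[ℂ] H) (z : ℂ) (J : V →L[ℂ] H) (Θ : V →L[ℂ] V) : H →L[ℂ] H :=
  K ∘L Ring.inverse (z • K - 1) ∘L (1 - z • (J ∘L chargeMap K z J Θ)) + J ∘L chargeMap K z J Θ

/-- z⁻¹ is non-real, hence outside the spectrum of K, and zK - 1 = -z(z⁻¹ - K). -/
theorem _root_.IsSelfAdjoint.isUnit_smul_sub_one {K : H →L[ℂ] H} (hK : IsSelfAdjoint K)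
    {z : ℂ} (hz : z.im ≠ 0) : IsUnit (z • K - 1) := by
  have hz0 : z ≠ 0 := by rintro rfl; simp at hz
  have h1 : z⁻¹ ∉ spectrum ℂ K := fun h => by
    have := hK.im_eq_zero_of_mem_spectrum h
    rw [Complex.inv_im, div_eq_zero_iff] at this
    rcases this with h | h
    · exact hz (neg_eq_zero.1 h)
    · exact hz0 (Complex.normSq_eq_zero.1 h)
  have h2 := (spectrum.notMem_iff.1 h1).neg
  have h3 : z • K - 1 = (Units.mk0 z hz0) • -(algebraMap ℂ (H →L[ℂ] H) z⁻¹ - K) := by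
    rw [Units.smul_mk0, Algebra.algebraMap_eq_smul_one, neg_sub, smul_sub, smul_smul,
      mul_inv_cancel₀ hz0, one_smul]
  rw [h3]
  exact h2.smul _

theorem _root_.Filter.Tendsto.clm_comp {ι E F G : Type*} [NormedAddCommGroup E]
    [NormedSpace ℂ E] [NormedAddCommGroup F] [NormedSpace ℂ F] [NormedAddCommGroup G]
    [NormedSpace ℂ G] {l : Filter ι} {g : ι → F →L[ℂ] G} {f : ι → E →L[ℂ] F} {g₀ : F →L[ℂ] G}
    {f₀ : E →L[ℂ] F} (hg : Tendsto g l (𝓝 g₀)) (hf : Tendsto f l (𝓝 f₀)) :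
    Tendsto (fun i => g i ∘L f i) l (𝓝 (g₀ ∘L f₀)) :=
  ((isBoundedBilinearMap_comp (𝕜 := ℂ)).continuous.tendsto (g₀, f₀)).comp (hg.prodMk_nhds hf)

variable {T : H →ₗ.[ℂ] H} {K : H →L[ℂ] H} {J : V →L[ℂ] H} {Θ : V →L[ℂ] V} {z : ℂ}

theorem IsSingularPerturbation.isFormalAdjoint (hT : T.IsSingularPerturbation K J Θ)
    (hK : IsSelfAdjoint K) (hΘ : LinearMap.IsSymmetric (𝕜 := ℂ) (E := V) Θ) :
    T.IsFormalAdjoint T := by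
  intro x y
  obtain ⟨ξ, hξ, hx⟩ := (hT _ _).1 (T.mem_graph x)
  obtain ⟨η, hη, hy⟩ := (hT _ _).1 (T.mem_graph y)
  have hs : ⟪Θ ξ, η⟫_ℂ = ⟪ξ, Θ η⟫_ℂ := hΘ ξ η
  have hKs : ⟪K (T x), T y⟫_ℂ = ⟪T x, K (T y)⟫_ℂ := hK.isSymmetric (T x) (T y)
  rw [hx, hy, inner_add_right, inner_add_left, hKs, ← ContinuousLinearMap.adjoint_inner_left J,
    ← ContinuousLinearMap.adjoint_inner_right J,
    eq_neg_of_add_eq_zero_left hξ, eq_neg_of_add_eq_zero_left hη, inner_neg_left, inner_neg_right,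
    hs]

/-- In finite dimension injectivity suffices. If Wξ = 0, then ψ = -zSJξ satisfies the boundary
condition and Kψ + Jξ is an eigenvector for z unless it vanishes. Symmetry makes it vanish, so ψ =
0, Jξ = 0 and ξ = 0. -/
theorem IsSingularPerturbation.isUnit_weylOperator [FiniteDimensional ℂ V]
    (hT : T.IsSingularPerturbation K J Θ)
    (hK : IsSelfAdjoint K) (hΘ : LinearMap.IsSymmetric (𝕜 := ℂ) (E := V) Θ)
    (hJ : Function.Injective J) (hz : z.im ≠ 0) : IsUnit (weylOperator K z J Θ) := by
  rw [ContinuousLinearMap.isUnit_iff_isUnit_toLinearMap, LinearMap.isUnit_iff_ker_eq_bot,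
    LinearMap.ker_eq_bot']
  intro ξ hξ
  replace hξ : Θ ξ - z • ContinuousLinearMap.adjoint J (Ring.inverse (z • K - 1) (J ξ)) = 0 := hξ
  set S := Ring.inverse (z • K - 1) with hS
  have hSr : (z • K - 1) * S = 1 := Ring.mul_inverse_cancel _ (hK.isUnit_smul_sub_one hz)
  have hSa : z • K (S (J ξ)) - S (J ξ) = J ξ := DFunLike.congr_fun hSr (J ξ)
  have hg : (K (-(z • S (J ξ))) + J ξ, -(z • S (J ξ))) ∈ T.graph := by
    refine (hT _ _).2 ⟨ξ, ?_, rfl⟩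
    rw [_root_.map_neg, _root_.map_smul]
    linear_combination (norm := module) hξ
  obtain ⟨x, hx1, hx2⟩ := (T.mem_graph_iff).1 hg
  simp only at hx1 hx2
  have hTx : T x = z • (x : H) := by
    rw [hx1, hx2, _root_.map_neg, _root_.map_smul]
    -- Only the Jξ standing outside S is expanded.
    nth_rewrite 3 [← hSa]
    module
  have hx0 := (hT.isFormalAdjoint hK hΘ).eq_zero_of_apply_eq_smul hz hTx
  rw [hx0, smul_zero] at hTx
  rw [hx0, ← hx2, hTx, _root_.map_zero, zero_add] at hx1
  exact hJ (by rw [← hx1, _root_.map_zero])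

theorem IsSingularPerturbation.isResolventAt [FiniteDimensional ℂ V]
    (hT : T.IsSingularPerturbation K J Θ)
    (hK : IsSelfAdjoint K) (hΘ : LinearMap.IsSymmetric (𝕜 := ℂ) (E := V) Θ)
    (hJ : Function.Injective J) (hz : z.im ≠ 0) :
    T.IsResolventAt z (kreinResolvent K z J Θ) := by
  refine (hT.isFormalAdjoint hK hΘ).isResolventAt hz fun y => ?_
  set S := Ring.inverse (z • K - 1) with hS
  have hSr : (z • K - 1) * S = 1 := Ring.mul_inverse_cancel _ (hK.isUnit_smul_sub_one hz)
  have hMr : weylOperator K z J Θ * Ring.inverse (weylOperator K z J Θ) = 1 :=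
    Ring.mul_inverse_cancel _ (hT.isUnit_weylOperator hK hΘ hJ hz)
  set ξ := chargeMap K z J Θ y with hξ
  have hSa : z • K (S (y - z • J ξ)) - S (y - z • J ξ) = y - z • J ξ := DFunLike.congr_fun hSr _
  have hMξ : Θ ξ - z • ContinuousLinearMap.adjoint J (S (J ξ)) = -ContinuousLinearMap.adjoint J (S y) := by
    have := DFunLike.congr_fun hMr (-ContinuousLinearMap.adjoint J (S y))
    have h2 : ξ = Ring.inverse (weylOperator K z J Θ) (-ContinuousLinearMap.adjoint J (S y)) := by
      rw [_root_.map_neg]; rfl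
    rw [mul_apply_eq_comp, ← h2] at this
    exact this
  have hRy : kreinResolvent K z J Θ y = K (S (y - z • J ξ)) + J ξ := rfl
  have hg : (kreinResolvent K z J Θ y, S (y - z • J ξ)) ∈ T.graph := by
    refine (hT _ _).2 ⟨ξ, ?_, hRy⟩
    rw [_root_.map_sub, _root_.map_smul, _root_.map_sub, _root_.map_smul]
    linear_combination (norm := module) hMξ
  refine ⟨T.mem_domain_of_mem_graph hg, ?_⟩
  obtain ⟨x, hx1, hx2⟩ := (T.mem_graph_iff).1 hg
  simp only at hx1 hx2
  have hxe : (⟨_, T.mem_domain_of_mem_graph hg⟩ : T.domain) = x := Subtype.ext hx1.symm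
  rw [hxe, hx2, hRy, smul_add]
  linear_combination (norm := module) hSa

theorem IsSingularPerturbation.isSelfAdjoint [FiniteDimensional ℂ V]
    (hT : T.IsSingularPerturbation K J Θ)
    (hK : IsSelfAdjoint K) (hΘ : LinearMap.IsSymmetric (𝕜 := ℂ) (E := V) Θ)
    (hJ : Function.Injective J) (hd : Dense (T.domain : Set H)) : IsSelfAdjoint T := by
  have hs {z : ℂ} (hz : z.im ≠ 0) (y : H) : ∃ x : T.domain, -T x + z • (x : H) = y :=
    let ⟨h, e⟩ := (hT.isResolventAt hK hΘ hJ hz).2 y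
    ⟨⟨_, h⟩, e⟩
  exact (hT.isFormalAdjoint hK hΘ).isSelfAdjoint hd (z := Complex.I) (hs (by simp)) (hs (by simp))

theorem tendsto_kreinResolvent {ι : Type*} {l : Filter ι} {JN : ι → V →L[ℂ] H}
    {ΘN : ι → V →L[ℂ] V} (hJ : Tendsto JN l (𝓝 J)) (hΘ : Tendsto ΘN l (𝓝 Θ))
    (hM : IsUnit (weylOperator K z J Θ)) :
    Tendsto (fun N => kreinResolvent K z (JN N) (ΘN N)) l (𝓝 (kreinResolvent K z J Θ)) := by
  have hJa : Tendsto (fun N => ContinuousLinearMap.adjoint (JN N)) l (𝓝 (ContinuousLinearMap.adjoint J)) :=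
    ((ContinuousLinearMap.adjoint (𝕜 := ℂ) (E := V) (F := H)).continuous.tendsto J).comp hJ
  have hW : Tendsto (fun N => weylOperator K z (JN N) (ΘN N)) l (𝓝 (weylOperator K z J Θ)) :=
    hΘ.sub ((hJa.clm_comp (tendsto_const_nhds.clm_comp hJ)).const_smul z)
  have hWi : Tendsto (fun N => Ring.inverse (weylOperator K z (JN N) (ΘN N))) l
      (𝓝 (Ring.inverse (weylOperator K z J Θ))) := by
    -- `Ring.inverse` is continuous at units, so only the limit has to be invertible.
    obtain ⟨u, hu⟩ := hM
    rw [← hu] at hW ⊢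
    exact (NormedRing.inverse_continuousAt u).tendsto.comp hW
  have hC : Tendsto (fun N => chargeMap K z (JN N) (ΘN N)) l (𝓝 (chargeMap K z J Θ)) :=
    (hWi.clm_comp (hJa.clm_comp tendsto_const_nhds)).neg
  have hJC := hJ.clm_comp hC
  exact (tendsto_const_nhds.clm_comp (tendsto_const_nhds.clm_comp
    (tendsto_const_nhds.sub (hJC.const_smul z)))).add hJC

end Krein

/-! ### The extensions as singular perturbations -/

section Extension

variable {H : Type*} [NormedAddCommGroup H] [InnerProductSpace ℂ H] [CompleteSpace H]
  {A : H →ₗ.[ℂ] H} {n : ℕ} {τ : GraphDomain A →L[ℂ] EuclideanSpace ℂ (Fin n)}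
  {P : EuclideanSpace ℂ (Fin n) →L[ℂ] EuclideanSpace ℂ (Fin n)}

variable (A τ P) in
/-- The restriction of `G₀` to `ran Π`. -/
def gammaFieldOn : P.range →L[ℂ] H := A.gammaField τ 0 ∘L P.range.subtypeL

omit [CompleteSpace H] in
theorem apply_neg_resolvent_zero (h0 : (0 : ℂ) ∈ A.resolventSet) (y : H) :
    A (GraphDomain.toDomain A (-A.resolventToDomain 0 y)) = y := by
  obtain ⟨h, e⟩ := (isResolventAt_resolvent h0).2 y
  rw [zero_smul, add_zero] at e
  rw [_root_.map_neg, LinearPMap.map_neg]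
  exact e

omit [CompleteSpace H] in
theorem neg_resolventToDomain_zero_apply (h0 : (0 : ℂ) ∈ A.resolventSet) (φ : GraphDomain A) :
    -A.resolventToDomain 0 (A (GraphDomain.toDomain A φ)) = φ := by
  apply (GraphDomain.toDomain A).injective
  apply Subtype.ext
  have := (isResolventAt_resolvent h0).1 (GraphDomain.toDomain A φ)
  rw [zero_smul, add_zero, _root_.map_neg] at this
  rw [_root_.map_neg, Submodule.coe_neg, ← this]
  rfl

theorem isSelfAdjoint_neg_resolvent_zero (hA : IsSelfAdjoint A)
    (h0 : (0 : ℂ) ∈ A.resolventSet) : IsSelfAdjoint (-A.resolvent 0) := by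
  rw [ContinuousLinearMap.isSelfAdjoint_iff_isSymmetric]
  intro x y
  have hsym := A.adjoint_isFormalAdjoint hA.dense_domain
  rw [isSelfAdjoint_def.mp hA] at hsym
  have := hsym (GraphDomain.toDomain A (-A.resolventToDomain 0 x))
    (GraphDomain.toDomain A (-A.resolventToDomain 0 y))
  rw [apply_neg_resolvent_zero h0, apply_neg_resolvent_zero h0] at this
  exact this.symm

/-- ⟪G₀ξ, -Aφ⟫ = ⟪ξ, τφ⟫, and surjectivity of τ allows τφ = ξ. -/
theorem gammaField_zero_injective (h0 : (0 : ℂ) ∈ A.resolventSet)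
    (hτ : Function.Surjective τ) : Function.Injective (A.gammaField τ 0) := by
  rw [injective_iff_map_eq_zero]
  intro ξ hξ
  obtain ⟨φ, hφ⟩ := hτ ξ
  have h : ⟪A.gammaField τ 0 ξ, -A (GraphDomain.toDomain A φ)⟫_ℂ = ⟪ξ, ξ⟫_ℂ := by
    rw [gammaField, ContinuousLinearMap.adjoint_inner_left, _root_.map_zero,
      ContinuousLinearMap.comp_apply, _root_.map_neg, neg_resolventToDomain_zero_apply h0, hφ]
  rw [hξ, inner_zero_left] at h
  exact inner_self_eq_zero.1 h.symm

theorem coe_adjoint_gammaFieldOn (hP : IsStarProjection P) (y : H) :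
    (ContinuousLinearMap.adjoint (𝕜 := ℂ) (E := P.range) (A.gammaFieldOn τ P) y :
      EuclideanSpace ℂ (Fin n)) = P (τ (A.resolventToDomain 0 y)) := by
  have hPP (v : P.range) : P v = v := by
    obtain ⟨_, w, rfl⟩ := v
    exact DFunLike.congr_fun hP.isIdempotentElem.eq w
  have hmem : P (τ (A.resolventToDomain 0 y)) ∈ P.range := ⟨_, rfl⟩
  have : ContinuousLinearMap.adjoint (𝕜 := ℂ) (E := P.range) (A.gammaFieldOn τ P) y = ⟨_, hmem⟩ := by
    refine ext_inner_left ℂ fun v => ?_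
    have hs : ⟪P v, τ (A.resolventToDomain 0 y)⟫_ℂ = ⟪(v : EuclideanSpace ℂ (Fin n)),
      P (τ (A.resolventToDomain 0 y))⟫_ℂ := hP.isSelfAdjoint.isSymmetric _ _
    rw [ContinuousLinearMap.adjoint_inner_right, Submodule.coe_inner, ← hs, hPP,
      gammaFieldOn, ContinuousLinearMap.comp_apply, Submodule.subtypeL_apply, gammaField, ContinuousLinearMap.adjoint_inner_left,
      _root_.map_zero]
    rfl
  rw [this]

theorem isSingularPerturbation_extension (hA : IsSelfAdjoint A)
    (h0 : (0 : ℂ) ∈ A.resolventSet) (hτ : Dense ((A.restrictKer τ).domain : Set H))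
    (hP : IsStarProjection P) (Θ : P.range →L[ℂ] P.range) :
    (A.extension τ P Θ).IsSingularPerturbation (V := P.range) (-A.resolvent 0)
      (A.gammaFieldOn τ P) Θ := by
  intro x y
  rw [extension_graph hA h0 hτ]
  have hiff (ξ : P.range) (y : H) : ContinuousLinearMap.adjoint (𝕜 := ℂ)
      (E := P.range) (A.gammaFieldOn τ P) y + Θ ξ = 0 ↔
        P (τ (-A.resolventToDomain 0 y)) = (Θ ξ : EuclideanSpace ℂ (Fin n)) := by
    rw [← Subtype.coe_inj, Submodule.coe_add, coe_adjoint_gammaFieldOn hP,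
      Submodule.coe_zero, _root_.map_neg, _root_.map_neg, add_eq_zero_iff_neg_eq]
  constructor
  · rintro ⟨φ, ξ, h, e⟩
    obtain ⟨rfl, rfl⟩ := Prod.ext_iff.1 e
    refine ⟨ξ, (hiff _ _).2 ?_, ?_⟩
    · rw [neg_resolventToDomain_zero_apply h0, h]
    · have := congrArg (fun ψ => (GraphDomain.toDomain A ψ : H))
        (neg_resolventToDomain_zero_apply h0 φ)
      exact congrArg (· + A.gammaField τ 0 (ξ : EuclideanSpace ℂ (Fin n))) this.symm
  · rintro ⟨ξ, h, rfl⟩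
    refine ⟨-A.resolventToDomain 0 y, ξ, (hiff _ _).1 h, ?_⟩
    rw [apply_neg_resolvent_zero h0]
    rfl

theorem restrictKer_le_extension (hA : IsSelfAdjoint A)
    (h0 : (0 : ℂ) ∈ A.resolventSet) (hτ : Dense ((A.restrictKer τ).domain : Set H))
    (Θ : P.range →L[ℂ] P.range) : A.restrictKer τ ≤ A.extension τ P Θ := by
  refine le_of_le_graph ?_
  rw [extension_graph hA h0 hτ]
  rintro ⟨x, y⟩ hxy
  obtain ⟨v, rfl, rfl⟩ := (mem_graph_iff _).1 hxy
  obtain ⟨φ, hφ, e⟩ := (mem_restrictKer_domain A τ v).1 v.2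
  refine ⟨φ, 0, by simp [hφ], ?_⟩
  have : A.restrictKer τ v = A (GraphDomain.toDomain A φ) :=
    -- ker τ is the case ξ = 0.
    (domRestrict_le (f := A)).2 e.symm
  rw [Submodule.coe_zero, _root_.map_zero, add_zero, this, e]

theorem tendsto_gammaFieldOn {ι : Type*} {l : Filter ι}
    {τN : ι → GraphDomain A →L[ℂ] EuclideanSpace ℂ (Fin n)} (hτ : Tendsto τN l (𝓝 τ)) :
    Tendsto (fun N => A.gammaFieldOn (τN N) P) l (𝓝 (A.gammaFieldOn τ P)) :=
  (((ContinuousLinearMap.adjoint (𝕜 := ℂ) (E := H)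
    (F := EuclideanSpace ℂ (Fin n))).continuous.tendsto _).comp
      (hτ.clm_comp tendsto_const_nhds)).clm_comp tendsto_const_nhds

end Extension

end LinearPMap

end

/-! ### Norm resolvent convergence -/

theorem lemma4p2 {H : Type*} [NormedAddCommGroup H] [InnerProductSpace ℂ H] [CompleteSpace H]
    (A : H →ₗ.[ℂ] H) (hA : IsSelfAdjoint A) (hA0 : (0 : ℂ) ∈ A.resolventSet) {n : ℕ}
    (τ : A.GraphDomain →L[ℂ] EuclideanSpace ℂ (Fin n))
    (hτ_surj : Function.Surjective τ)
    (hτ_dense : Dense ((A.restrictKer τ).domain : Set H))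
    (τN : ℕ → A.GraphDomain →L[ℂ] EuclideanSpace ℂ (Fin n))
    (hτN_surj : ∀ N, Function.Surjective (τN N))
    (hτN_dense : ∀ N, Dense ((A.restrictKer (τN N)).domain : Set H))
    (hτN : Filter.Tendsto τN Filter.atTop (nhds τ))
    (P : EuclideanSpace ℂ (Fin n) →L[ℂ] EuclideanSpace ℂ (Fin n)) (hP : IsStarProjection P)
    (Θ : P.range →L[ℂ] P.range) (hΘ_symm : LinearMap.IsSymmetric (𝕜 := ℂ) (E := P.range) Θ)
    (ΘN : ℕ → P.range →L[ℂ] P.range) (hΘN_symm : ∀ N, LinearMap.IsSymmetric (𝕜 := ℂ) (E := P.range) (ΘN N))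
    (hΘN : Filter.Tendsto ΘN Filter.atTop (nhds Θ)) :
    (∀ N, A.restrictKer (τN N) ≤ A.extension (τN N) P (ΘN N)) ∧
      A.restrictKer τ ≤ A.extension τ P Θ ∧
      LinearPMap.NormResolventTendsto (fun N => A.extension (τN N) P (ΘN N))
        (A.extension τ P Θ) := by
  have hJinj {σ : A.GraphDomain →L[ℂ] EuclideanSpace ℂ (Fin n)} (hσ : Function.Surjective σ) :
      Function.Injective (A.gammaFieldOn σ P) :=
    (LinearPMap.gammaField_zero_injective hA0 hσ).comp Subtype.val_injective
  have hK := LinearPMap.isSelfAdjoint_neg_resolvent_zero hA hA0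
  have hle {σ : A.GraphDomain →L[ℂ] EuclideanSpace ℂ (Fin n)}
      (hσ : Dense ((A.restrictKer σ).domain : Set H)) (Ξ : P.range →L[ℂ] P.range) :=
    LinearPMap.restrictKer_le_extension hA hA0 hσ Ξ
  have hT := LinearPMap.isSingularPerturbation_extension hA hA0 hτ_dense hP Θ
  have hTN N := LinearPMap.isSingularPerturbation_extension hA hA0 (hτN_dense N) hP (ΘN N)
  refine ⟨fun N => hle (hτN_dense N) _, hle hτ_dense _, fun N => ?_, ?_, fun z hz => ?_⟩
  · exact (hTN N).isSelfAdjoint hK (hΘN_symm N) (hJinj (hτN_surj N))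
      ((hτN_dense N).mono (hle (hτN_dense N) _).1)
  · exact hT.isSelfAdjoint hK hΘ_symm (hJinj hτ_surj) (hτ_dense.mono (hle hτ_dense _).1)
  have hR := hT.isResolventAt hK hΘ_symm (hJinj hτ_surj) hz
  have hRN N := (hTN N).isResolventAt hK (hΘN_symm N) (hJinj (hτN_surj N)) hz
  refine ⟨fun N => (hRN N).mem_resolventSet, hR.mem_resolventSet, ?_⟩
  simp only [(hRN _).resolvent_eq, hR.resolvent_eq]
  exact LinearPMap.tendsto_kreinResolvent (LinearPMap.tendsto_gammaFieldOn hτN) hΘN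
    (hT.isUnit_weylOperator hK hΘ_symm (hJinj hτ_surj) hz)
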